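/- Let $m\ge 1$, $\omega=e^{2\pi i/m}$, and let $\mathfrak g=\bigoplus_{l\in\mathbb Z/m}\mathfrak g_l$ be a finite-dimensional complex semisimple Lie algebra with a $\mathbb Z/m$-grading ($[\mathfrak g_i,\mathfrak g_l]\subseteq\mathfrak g_{i+l}$); let $\theta$ be the automorphism acting as $\omega^l$ on $\mathfrak g_l$. A subspace $A$ of $\mathfrak g$ is homogeneous if $A=\bigoplus_l (A\cap\mathfrak g_l)$, and then $A_l:=A\cap\mathfrak g_l$. Let $\mathfrak c\subseteq\mathfrak g_1$ be a Cartan subspace, i.e. a maximal abelian subspace of $\mathfrak g_1$ consisting of semisimple elements, and let $\mathfrak c_{\mathfrak g}(\mathfrak c)$ be its centralizer in $\mathfrak g$. Let $\mathfrak h$ be an adapted Cartan subalgebra of $\mathfrak g$, i.e. a homogeneous Cartan subalgebra with $\mathfrak h\supseteq\mathfrak z(\mathfrak c_{\mathfrak g}(\mathfrak c))$ and $\mathfrak h_1=\mathfrak c$, and let $\Phi\subset\mathfrak h^*$ be the set of roots. Let $\mathfrak p$ be a parabolic subalgebra of $\mathfrak g$ (one containing a maximal solvable subalgebra) with a homogeneous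 Levi factor $\mathfrak l$ (a subalgebra complementary in $\mathfrak p$ to the nilradical of $\mathfrak p$) such that $\mathfrak l\supseteq\mathfrak c_{\mathfrak g}(\mathfrak c)$. Then: 1. There is a $\mathbb Z$-grading $\mathfrak g=\bigoplus_{j\in\mathbb Z}\mathfrak g(j)$ of the Lie algebra $\mathfrak g$ with $\mathfrak p=\bigoplus_{j\ge 0}\mathfrak g(j)$ and $\mathfrak l=\mathfrak g(0)$. 2. For every such $\mathbb Z$-grading there is a unique $Z\in\mathfrak g$ with $[Z,X]=jX$ for all $j\in\mathbb Z$ and $X\in\mathfrak g(j)$ (the grading element), and $Z\in\mathfrak h$. Write $Z=\sum_{l\in\mathbb Z/m} Z_l$ with $Z_l\in\mathfrak h_l$. For every root $\alpha\in\Phi$, let $\lambda_0=\alpha(Z_0)$ be its $0$-th mode and put $n_l=\alpha(\theta^l(Z))$ for $l\in\mathbb Z/m$. Then $n_l\in\mathbb Z$ for all $l$, and $$m\lambda_0=\sum_{l\in\mathbb Z/m}n_l,\qquad\text{so that}\qquad \lambda_0\in\tfrac1m\mathbb Z.$$ 3. If $\mathfrak h_0=0$ and $\mathfrak p\neq\mathfrak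 g$, then $\mathfrak p$ is not $\theta$-stable. -/

import Mathlib

/-- The primitive root of unity `ω = exp (2πi/m)`. -/
noncomputable def cyclicRoot (m : ℕ) : ℂ :=
  Complex.exp (2 * Real.pi * Complex.I / m)

section CyclicGrading

variable {m : ℕ} [NeZero m] {g : Type*} [LieRing g] [LieAlgebra ℂ g]
  (A : ZMod m → Submodule ℂ g) [GradedLieAlgebra A]

/-- The projection of `g` onto the homogeneous component `A l` of a `ℤ/m`-grading. -/
noncomputable def gradedProj (l : ZMod m) : g →ₗ[ℂ] g :=
  (A l).subtype ∘ₗ DirectSum.component ℂ (ZMod m) (fun i => A i) l ∘ₗ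
    (DirectSum.decomposeLinearEquiv A).toLinearMap

/-- The automorphism `θ` of a `ℤ/m`-graded Lie algebra, acting as `ω ^ l` on `A l`. -/
noncomputable def theta : g →ₗ[ℂ] g :=
  ∑ l : ZMod m, cyclicRoot m ^ l.val • gradedProj A l

theorem theta_apply_of_mem {l : ZMod m} {x : g} (hx : x ∈ A l) :
    theta A x = cyclicRoot m ^ l.val • x := by
  have e (i : ZMod m) : gradedProj A i x = (DirectSum.decompose A x i : g) := rfl
  simp only [theta, LinearMap.sum_apply, LinearMap.smul_apply, e]
  rw [Finset.sum_eq_single l]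
  · rw [DirectSum.decompose_of_mem_same A hx]
  · intro i _ hi
    rw [DirectSum.decompose_of_mem_ne A hx (Ne.symm hi), smul_zero]
  · simp

/-- A subalgebra `W` is homogeneous, `W = ⨁ (W ∩ A l)`: it contains the homogeneous components of
its elements. -/
def IsHomogeneousSubalgebra (W : LieSubalgebra ℂ g) : Prop :=
  ∀ l : ZMod m, ∀ x ∈ W, gradedProj A l x ∈ W

theorem theta_mem {W : LieSubalgebra ℂ g} (hW : IsHomogeneousSubalgebra A W)
    {x : g} (hx : x ∈ W) : theta A x ∈ W := by
  simp only [theta, LinearMap.sum_apply, LinearMap.smul_apply]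
  exact sum_mem fun l _ => W.smul_mem _ (hW l x hx)

theorem theta_pow_mem {W : LieSubalgebra ℂ g} (hW : IsHomogeneousSubalgebra A W)
    {x : g} (hx : x ∈ W) (k : ℕ) : (theta A ^ k) x ∈ W := by
  induction k with
  | zero => simpa using hx
  | succ k ih =>
    rw [pow_succ', Module.End.mul_apply]
    exact theta_mem A hW ih

/-- `W` is `θ`-stable. -/
def IsThetaStable (W : LieSubalgebra ℂ g) : Prop :=
  ∀ x ∈ W, theta A x ∈ W

/-- `c` is a Cartan subspace: a maximal abelian subspace of `V = A 1` consisting of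
semisimple elements. -/
def IsCartanSubspace (c : Submodule ℂ g) : Prop :=
  Maximal (fun d : Submodule ℂ g => d ≤ A 1 ∧ (∀ x ∈ d, ∀ y ∈ d, ⁅x, y⁆ = 0) ∧
    ∀ x ∈ d, (LieAlgebra.ad ℂ g x).IsSemisimple) c

end CyclicGrading

section Subalgebras

variable {g : Type*} [LieRing g] [LieAlgebra ℂ g]

/-- The centralizer in `g` of a subspace. -/
def lieCentralizer (c : Submodule ℂ g) : LieSubalgebra ℂ g where
  carrier := {x | ∀ y ∈ c, ⁅x, y⁆ = 0}
  zero_mem' := fun y _ => zero_lie y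
  add_mem' := fun {a b} ha hb y hy => by rw [add_lie, ha y hy, hb y hy, add_zero]
  smul_mem' := fun t a ha y hy => by rw [smul_lie, ha y hy, smul_zero]
  lie_mem' := fun {a b} ha hb y hy => by rw [lie_lie, hb y hy, ha y hy, lie_zero, lie_zero, sub_zero]

/-- A Borel subalgebra: a maximal solvable subalgebra. -/
def IsBorelSubalgebra (b : LieSubalgebra ℂ g) : Prop :=
  Maximal (fun s : LieSubalgebra ℂ g => LieAlgebra.IsSolvable s) b

/-- A parabolic subalgebra: a subalgebra containing a Borel subalgebra. -/
def IsParabolicSubalgebra (p : LieSubalgebra ℂ g) : Prop :=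
  ∃ b : LieSubalgebra ℂ g, IsBorelSubalgebra b ∧ b ≤ p

/-- The nilradical of `p`, as a subspace of `g`: the sum of all ideals of `p` which are nilpotent
as Lie algebras. -/
noncomputable def lieNilradical (p : LieSubalgebra ℂ g) : Submodule ℂ g :=
  (sSup {I : LieIdeal ℂ p | LieRing.IsNilpotent I}).toSubmodule.map p.toSubmodule.subtype

/-- `l` is a Levi factor of the parabolic subalgebra `p` (of a semisimple Lie algebra): a
subalgebra with `p = l ⊕ n` as vector spaces, where `n` is the nilradical of `p`. -/
def IsLeviFactor (p l : LieSubalgebra ℂ g) : Prop :=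
  Disjoint l.toSubmodule (lieNilradical p) ∧ l.toSubmodule ⊔ lieNilradical p = p.toSubmodule

/-- The `ℤ`-grading `B` of `g` satisfies `p = ⨁_{j ≥ 0} g(j)` and `l = g(0)`. -/
def GradingDefines (B : ℤ → Submodule ℂ g) (p l : LieSubalgebra ℂ g) : Prop :=
  p.toSubmodule = (⨆ j : ℤ, ⨆ _ : 0 ≤ j, B j) ∧ l.toSubmodule = B 0

/-- `Z` is a grading element of the `ℤ`-grading `B` of `g`. -/
def IsGradingElement (B : ℤ → Submodule ℂ g) (Z : g) : Prop :=
  ∀ j : ℤ, ∀ x ∈ B j, ⁅Z, x⁆ = (j : ℂ) • x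

end Subalgebras

section Adapted

variable {m : ℕ} [NeZero m] {g : Type*} [LieRing g] [LieAlgebra ℂ g]
  (A : ZMod m → Submodule ℂ g) [GradedLieAlgebra A]

/-- A Cartan subalgebra `h` of `g` is adapted (to the Cartan subspace `c`) if it is homogeneous,
contains the centre of the centralizer of `c`, and satisfies `h ∩ A 1 = c`. -/
structure IsAdapted (c : Submodule ℂ g) (h : LieSubalgebra ℂ g) [h.IsCartanSubalgebra] : Prop where
  homogeneous : IsHomogeneousSubalgebra A h
  center_le : ∀ x : lieCentralizer c, x ∈ LieAlgebra.center ℂ (lieCentralizer c) → (x : g) ∈ h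
  degree_one : h.toSubmodule ⊓ A 1 = c

variable {h : LieSubalgebra ℂ g} (hh : IsHomogeneousSubalgebra A h)

/-- The `l`-th mode `λ_l = α_l (Z_l)` of a linear form on a homogeneous subalgebra `h`, where
`Z_l` is the component of `Z ∈ h` of degree `l`. -/
noncomputable def mode (α : h → ℂ) (Z : h) (l : ZMod m) : ℂ :=
  α ⟨gradedProj A l Z, hh l Z Z.2⟩

/-- The numbers `n_l = α (θ ^ l Z)`. -/
noncomputable def thetaValue (α : h → ℂ) (Z : h) (l : ZMod m) : ℂ :=
  α ⟨(theta A ^ l.val) Z, theta_pow_mem A hh Z.2 l.val⟩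

end Adapted

/-!
A subalgebra `p` which contains a Cartan subalgebra `h` and a maximal solvable subalgebra `b` is
described by its weights. For the Killing form, `b` contains its orthogonal complement
(`LieSubalgebra.mem_of_maximal_isSolvable_of_killingForm_eq_zero`, from Lie's theorem and Cartan's
criterion), so `p` contains its own orthogonal complement; hence for every root `α`, one of `α` and
`-α` is a root of `p`. In the situation of the theorem `h` centralizes `c`, so `h ≤ l ≤ p`.

The grading is given by the eigenvalues of `ad Z`, where `Z` is the sum of the coroots `α^∨` over
the roots `α` of `p` such that `-α` is not a root of `p`. The reflection in a root `β` of `p` either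
preserves this set of roots (if `-β` is also a root of `p`, which forces `β(Z) = 0`) or maps those
`α` with `⟨α, β^∨⟩ < 0` into it, because root strings are unbroken (which forces `β(Z) > 0`). So the
roots of `p` are those with `α(Z) ≥ 0`; see `LieSubalgebra.exists_forall_weight_apply_eq_intCast`.
The nilradical of `p` is the sum of the eigenspaces of positive degree
(`sSup_isNilpotent_map_subtype_eq_iSup_eigenspace_ad`), and a Levi factor containing `h` must then
be the eigenspace of degree zero.

For any grading of this kind the degree derivation is inner, which gives the grading element `Z`; it
commutes with `h ≤ l`, so it lies in `h`. As `θ` is an automorphism, `α(θ^k Z)` is the eigenvalue of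
`Z` on the vector `θ^(-k) x`, for `x` a root vector of `α`; hence it is an integer, and it is
non-negative if `p` is `θ`-stable and contains `x`. Since `∑ θ^k Z = m Z_0`, the sum of these
integers is `m α(Z_0)`. If `h_0 = 0` and `p` is `θ`-stable, all of them vanish for the roots of `p`,
so every root space has degree zero and `p` is the whole algebra.
-/

/-! ### Solvable subalgebras and the Killing form -/

section Solvable

open LieModule

variable {K : Type*} [Field K] [CharZero K] [IsAlgClosed K]

/-- A form of Lie's theorem: in a simultaneous triangularization the commutators become strictly
upper triangular. -/
theorem isNilpotent_toEnd_mul_toEnd_lie_of_isSolvable {L : Type*} [LieRing L] [LieAlgebra K L]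
    [LieAlgebra.IsSolvable L] (V : Type*) [AddCommGroup V] [Module K V] [FiniteDimensional K V]
    [LieRingModule L V] [LieModule K L V] (x y z : L) :
    IsNilpotent (toEnd K L V x * toEnd K L V ⁅y, z⁆) := by
  induction hn : Module.finrank K V using Nat.strong_induction_on generalizing V with
  | _ n ih =>
  obtain hV | hV := subsingleton_or_nontrivial V
  · exact ⟨1, Subsingleton.elim _ _⟩
  obtain ⟨χ, hχ⟩ := exists_nontrivial_weightSpace_of_isSolvable K L V
  obtain ⟨⟨v, hv⟩, hv0⟩ := exists_ne (0 : weightSpace V χ)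
  rw [mem_weightSpace] at hv
  replace hv0 : v ≠ 0 := fun h => hv0 (Subtype.ext h)
  let W : LieSubmodule K L V :=
    { Submodule.span K {v} with
      lie_mem := by
        intro a w hw
        obtain ⟨t, rfl⟩ := Submodule.mem_span_singleton.mp hw
        rw [lie_smul, hv a]
        exact Submodule.smul_mem _ _
          (Submodule.smul_mem _ _ (Submodule.mem_span_singleton_self v)) }
  have hW : ∀ w, w ∈ W ↔ ∃ t : K, t • v = w := fun w => Submodule.mem_span_singleton
  have hlt : Module.finrank K (V ⧸ W) < n := by
    have h1 := Submodule.finrank_quotient_add_finrank W.toSubmodule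
    have h2 : Module.finrank K W.toSubmodule = 1 := finrank_span_singleton hv0
    have h3 : Module.finrank K (V ⧸ W) = Module.finrank K (V ⧸ W.toSubmodule) := rfl
    omega
  obtain ⟨k, hk⟩ := ih _ hlt (V ⧸ W) rfl
  have hmk (k : ℕ) (w : V) :
      ((toEnd K L (V ⧸ W) x * toEnd K L (V ⧸ W) ⁅y, z⁆) ^ k) (LieSubmodule.Quotient.mk w) =
        LieSubmodule.Quotient.mk (((toEnd K L V x * toEnd K L V ⁅y, z⁆) ^ k) w) := by
    induction k with
    | zero => simp
    | succ k ih => rw [pow_succ', pow_succ', Module.End.mul_apply, ih]; rfl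
  refine ⟨k + 1, LinearMap.ext fun w => ?_⟩
  have hw := hmk k w
  rw [hk, LinearMap.zero_apply, eq_comm, LieSubmodule.Quotient.mk_eq_zero'] at hw
  obtain ⟨t, ht⟩ := (hW _).mp hw
  -- a linear form on `L` coming from a one-dimensional module vanishes on commutators
  have hcomm : ⁅⁅y, z⁆, v⁆ = 0 := by
    rw [lie_lie, hv z, hv y, lie_smul, lie_smul, hv y, hv z, smul_comm, sub_self]
  rw [pow_succ', Module.End.mul_apply, ← ht]
  rw [map_smul, Module.End.mul_apply, toEnd_apply_apply, toEnd_apply_apply, hcomm, lie_zero,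
    smul_zero, LinearMap.zero_apply]

variable {L : Type*} [LieRing L] [LieAlgebra K L] [FiniteDimensional K L]

theorem LieSubalgebra.killingForm_lie_eq_zero_of_isSolvable (b : LieSubalgebra K L)
    [LieAlgebra.IsSolvable b] {x y z : L} (hx : x ∈ b) (hy : y ∈ b) (hz : z ∈ b) :
    killingForm K L x ⁅y, z⁆ = 0 :=
  (LinearMap.isNilpotent_trace_of_isNilpotent
    (isNilpotent_toEnd_mul_toEnd_lie_of_isSolvable (L := b) L
      ⟨x, hx⟩ ⟨y, hy⟩ ⟨z, hz⟩)).eq_zero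

omit [IsAlgClosed K] in
/-- Cartan's criterion for a subalgebra, with the Killing form of the ambient Lie algebra. -/
theorem LieSubalgebra.isSolvable_of_killingForm_lie_eq_zero (a : LieSubalgebra K L)
    (h : ∀ x ∈ a, ∀ y ∈ a, ∀ z ∈ a, killingForm K L x ⁅y, z⁆ = 0) :
    LieAlgebra.IsSolvable a := by
  set D : LieIdeal K a := ⁅(⊤ : LieIdeal K a), (⊤ : LieIdeal K a)⁆ with hD
  have key (x : a) {y : a} (hy : y ∈ D) : killingForm K L x y = 0 := by
    rw [hD, ← LieSubmodule.mem_toSubmodule, LieSubmodule.lieIdeal_oper_eq_linear_span'] at hy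
    induction hy using Submodule.span_induction with
    | mem y hy => obtain ⟨u, -, v, -, rfl⟩ := hy; exact h _ x.2 _ u.2 _ v.2
    | zero => simp
    | add u v _ _ hu hv => simp [hu, hv]
    | smul t u _ hu => simp [hu]
  have htf : traceForm K D L = 0 := by
    ext x y
    exact key x.1 y.2
  have hnil : LieModule.IsNilpotent (LieAlgebra.derivedSeries K D 1) L :=
    isNilpotent_derivedSeries_of_traceForm_eq_zero htf
  have hring : LieRing.IsNilpotent (LieAlgebra.derivedSeries K D 1) := by
    rw [LieAlgebra.isNilpotent_iff_forall (R := K)]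
    intro x
    obtain ⟨k, hk⟩ := (LieModule.isNilpotent_iff_forall' (R := K)).mp hnil x
    refine ⟨k, LinearMap.ext fun y => ?_⟩
    have hcoe (k : ℕ) : ((((LieAlgebra.ad K _ x ^ k) y : LieAlgebra.derivedSeries K D 1) : D) : L) =
        (toEnd K (LieAlgebra.derivedSeries K D 1) L x ^ k) ((y : D) : L) := by
      induction k with
      | zero => simp
      | succ k ih => rw [pow_succ', pow_succ', Module.End.mul_apply, Module.End.mul_apply, ← ih]; rfl
    have := hcoe k
    rw [hk] at this
    exact Subtype.ext (Subtype.ext (Subtype.ext this))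
  have hDsol : LieAlgebra.IsSolvable D := by
    obtain ⟨k, hk⟩ := LieAlgebra.IsSolvable.solvable K (LieAlgebra.derivedSeries K D 1)
    refine LieAlgebra.IsSolvable.mk (R := K) (k := k + 1) ?_
    rw [LieAlgebra.derivedSeries_def, LieAlgebra.derivedSeriesOfIdeal_add]
    exact (LieIdeal.derivedSeries_eq_bot_iff _ k).mp hk
  obtain ⟨k, hk⟩ := LieAlgebra.IsSolvable.solvable K D
  refine LieAlgebra.IsSolvable.mk (R := K) (k := k + 1) ?_
  rw [LieAlgebra.derivedSeries_def, LieAlgebra.derivedSeriesOfIdeal_add]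
  exact (LieIdeal.derivedSeries_eq_bot_iff _ k).mp hk

/-- A maximal solvable subalgebra `b` contains its orthogonal complement for the Killing form.
Otherwise, by Lie's theorem applied to the module `L ⧸ b`, some `x ∉ b` orthogonal to `b` satisfies
`⁅b, x⁆ ⊆ b + K x`; then `b + K x` is a subalgebra, solvable by Cartan's criterion. -/
theorem LieSubalgebra.mem_of_maximal_isSolvable_of_killingForm_eq_zero {b : LieSubalgebra K L}
    (hb : Maximal (fun s : LieSubalgebra K L => LieAlgebra.IsSolvable s) b) {x : L}
    (hx : ∀ y ∈ b, killingForm K L x y = 0) : x ∈ b := by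
  have hbs : LieAlgebra.IsSolvable b := hb.prop
  have hinv (u v w : L) : killingForm K L ⁅u, v⁆ w = killingForm K L u ⁅v, w⁆ :=
    traceForm_apply_lie_apply K L L u v w
  by_contra hxb
  let P : LieSubmodule K b L :=
    { (killingForm K L).orthogonal b.toSubmodule with
      lie_mem := by
        intro a w hw y hy
        have h1 : killingForm K L ⁅y, (a : L)⁆ w = 0 := hw _ (b.lie_mem hy a.2)
        rw [hinv] at h1
        exact h1 }
  have hP : ∀ w, w ∈ P ↔ ∀ y ∈ b, killingForm K L y w = 0 := fun w => Iff.rfl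
  let Q : LieSubmodule K b P := b.toLieSubmodule.comap P.incl
  have hQ (w : P) : w ∈ Q ↔ (w : L) ∈ b := Iff.rfl
  have hxP : x ∈ P := fun y hy => by
    have := hx y hy
    rwa [traceForm_comm] at this
  have hnt : Nontrivial (P ⧸ Q) := by
    refine nontrivial_of_ne (LieSubmodule.Quotient.mk ⟨x, hxP⟩) 0 ?_
    rw [Ne, LieSubmodule.Quotient.mk_eq_zero']
    exact hxb
  obtain ⟨χ, hχ⟩ := exists_nontrivial_weightSpace_of_isSolvable K b (P ⧸ Q)
  obtain ⟨⟨v, hv⟩, hv0⟩ := exists_ne (0 : weightSpace (P ⧸ Q) χ)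
  rw [mem_weightSpace] at hv
  replace hv0 : v ≠ 0 := fun h => hv0 (Subtype.ext h)
  obtain ⟨w, rfl⟩ := LieSubmodule.Quotient.surjective_mk' Q v
  obtain ⟨w, hw⟩ := w
  have hwb : w ∉ b := fun h => hv0 ((LieSubmodule.Quotient.mk_eq_zero').mpr h)
  have hlie (u : L) (hu : u ∈ b) : ∃ t : K, ⁅u, w⁆ - t • w ∈ b := by
    refine ⟨χ ⟨u, hu⟩, ?_⟩
    have h1 := hv ⟨u, hu⟩
    rw [← sub_eq_zero, ← map_smul, ← LieModuleHom.map_lie, ← map_sub] at h1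
    exact (LieSubmodule.Quotient.mk_eq_zero').mp h1
  have hsup (u : L) : u ∈ b.toSubmodule ⊔ Submodule.span K {w} ↔
      ∃ v ∈ b, ∃ t : K, v + t • w = u := by
    simp [Submodule.mem_sup, Submodule.mem_span_singleton]
  let a : LieSubalgebra K L :=
    { b.toSubmodule ⊔ Submodule.span K {w} with
      lie_mem' := by
        intro u v hu' hv'
        obtain ⟨u, hu, s, rfl⟩ := (hsup _).mp hu'
        obtain ⟨v, hv, t, rfl⟩ := (hsup _).mp hv'
        obtain ⟨s', hs⟩ := hlie u hu
        obtain ⟨t', ht⟩ := hlie v hv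
        refine (hsup _).mpr
          ⟨⁅u, v⁆ + t • (⁅u, w⁆ - s' • w) - s • (⁅v, w⁆ - t' • w),
            b.sub_mem (b.add_mem (b.lie_mem hu hv) (b.smul_mem _ hs)) (b.smul_mem _ ht),
            t * s' - s * t', ?_⟩
        simp only [lie_add, add_lie, lie_smul, smul_lie, lie_self, ← lie_skew w v]
        module }
  have ha (u : L) : u ∈ a ↔ ∃ v ∈ b, ∃ t : K, v + t • w = u := hsup u
  have hba : b ≤ a := fun u hu => (ha u).mpr ⟨u, hu, 0, by simp⟩
  have hasol : LieAlgebra.IsSolvable a := by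
    refine LieSubalgebra.isSolvable_of_killingForm_lie_eq_zero a ?_
    intro u hu' v hv' z hz'
    obtain ⟨u, hu, r, rfl⟩ := (ha u).mp hu'
    obtain ⟨v, hv, s, rfl⟩ := (ha v).mp hv'
    obtain ⟨z, hz, t, rfl⟩ := (ha z).mp hz'
    have hwl (u : L) (hu : u ∈ b) : killingForm K L w u = 0 := by
      rw [traceForm_comm]; exact hw u hu
    have e1 := LieSubalgebra.killingForm_lie_eq_zero_of_isSolvable b hu hv hz
    have e2 : killingForm K L w ⁅v, z⁆ = 0 := hwl _ (b.lie_mem hv hz)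
    have e3 (v : L) (hv : v ∈ b) : killingForm K L u ⁅v, w⁆ = 0 := by
      rw [← hinv]; exact hw _ (b.lie_mem hu hv)
    have e4 (v : L) : killingForm K L w ⁅v, w⁆ = 0 := by
      rw [← lie_skew, map_neg, ← hinv, lie_self, map_zero, LinearMap.zero_apply, neg_zero]
    simp only [lie_add, add_lie, lie_smul, smul_lie, lie_self, ← lie_skew w z, map_add, map_smul,
      map_neg, LinearMap.add_apply, LinearMap.smul_apply, e1, e2, e3 v hv, e3 z hz, e4,
      smul_zero, neg_zero, add_zero]
  exact hwb (hb.le_of_ge hasol hba ((ha w).mpr ⟨0, b.zero_mem, 1, by simp⟩))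

end Solvable

/-! ### Sums of coroots over a set of roots -/

section RootPairing

variable {ι R M N : Type*} [Finite ι] [CommRing R] [CharZero R] [AddCommGroup M] [Module R M]
  [AddCommGroup N] [Module R N] (P : RootPairing ι R M N) [P.IsCrystallographic]

omit [Finite ι] in
theorem RootPairing.pairingIn_int_reflectionPerm_self (i k : ι) :
    P.pairingIn ℤ i (P.reflectionPerm i k) = -P.pairingIn ℤ i k := by
  have h : (P.pairingIn ℤ i (P.reflectionPerm i k) : R) = -(P.pairingIn ℤ i k : R) := by
    have := P.algebraMap_pairingIn ℤ i k
    have h2 := P.algebraMap_pairingIn ℤ i (P.reflectionPerm i k)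
    rw [P.pairing_reflectionPerm, P.pairing_reflectionPerm_self_left, ← this] at h2
    simpa using h2
  exact_mod_cast h

omit [Finite ι] in
theorem RootPairing.sum_pairingIn_eq_zero_of_reflectionPerm_mem (s : Finset ι) (i : ι)
    (hs : ∀ k ∈ s, P.reflectionPerm i k ∈ s) : ∑ k ∈ s, P.pairingIn ℤ i k = 0 := by
  refine Finset.sum_involution (fun k _ => P.reflectionPerm i k) ?_ ?_ (fun k hk => hs k hk) ?_
  · intro k _
    rw [P.pairingIn_int_reflectionPerm_self, add_neg_cancel]
  · intro k _ h0 h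
    have := P.pairingIn_int_reflectionPerm_self i k
    rw [h] at this
    omega
  · intro k _
    exact P.reflectionPerm_self i k

/-- The reflection in `i` cancels the terms of the sum in pairs, except for indices `k ∈ s` whose
reflection lies outside `s`; those contribute non-negative terms, and `i` is one of them. -/
theorem RootPairing.sum_pairingIn_pos [IsDomain R] (s : Finset ι) {i : ι} (hi : i ∈ s)
    (hi' : P.reflectionPerm i i ∉ s)
    (hs : ∀ k ∈ s, P.pairingIn ℤ k i < 0 → P.reflectionPerm i k ∈ s) :
    0 < ∑ k ∈ s, P.pairingIn ℤ i k := by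
  classical
  rw [← Finset.sum_filter_add_sum_filter_not s (fun k => P.reflectionPerm i k ∈ s),
    P.sum_pairingIn_eq_zero_of_reflectionPerm_mem _ i, zero_add]
  · have h2 : P.pairingIn ℤ i i = 2 := P.pairingIn_same ℤ i
    have hnn : ∀ k ∈ s.filter (fun k => P.reflectionPerm i k ∉ s), 0 ≤ P.pairingIn ℤ i k := by
      intro k hk
      rw [Finset.mem_filter] at hk
      by_contra! hlt
      exact hk.2 (hs k hk.1 ((P.pairingIn_lt_zero_iff ℤ).mp hlt))
    have := Finset.single_le_sum hnn (Finset.mem_filter.mpr ⟨hi, hi'⟩)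
    omega
  · intro k hk
    rw [Finset.mem_filter] at hk ⊢
    exact ⟨hk.2, by simpa using hk.1⟩

end RootPairing

/-! ### Subalgebras containing a Cartan subalgebra -/

section RootSpaces

open LieAlgebra LieAlgebra.IsKilling LieModule

variable {K L : Type*} [Field K] [CharZero K] [LieRing L] [LieAlgebra K L] [FiniteDimensional K L]
  [IsKilling K L] {H : LieSubalgebra K L} [H.IsCartanSubalgebra] [IsTriangularizable K H L]

omit [CharZero K] [IsKilling K L] in
theorem Submodule.le_of_forall_mem_rootSpace {N M : Submodule K L}
    (hN : ∀ a ∈ H, ∀ x ∈ N, ⁅a, x⁆ ∈ N)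
    (h : ∀ α : Weight K H L, ∀ x ∈ N, x ∈ rootSpace H α → x ∈ M) : N ≤ M := by
  let N' : LieSubmodule K H L := { N with lie_mem := fun {a x} hx => hN a a.2 x hx }
  have h1 := congrArg LieSubmodule.toSubmodule (eq_iSup_inf_genWeightSpace K H L N')
  rw [LieSubmodule.iSup_toSubmodule] at h1
  change N = _ at h1
  rw [h1, iSup_le_iff]
  exact fun α x hx => h α x hx.1 hx.2

theorem Submodule.rootSpace_le_of_mem {N : Submodule K L} {α : Weight K H L} (hα : α.IsNonZero)
    {x : L} (hx : x ∈ N) (hxα : x ∈ rootSpace H α) (hx0 : x ≠ 0) :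
    (rootSpace H α).toSubmodule ≤ N := by
  intro y hy
  obtain ⟨t, ht⟩ := (finrank_eq_one_iff_of_nonzero' (⟨x, hxα⟩ : rootSpace H α)
    (fun h => hx0 (congrArg Subtype.val h))).mp (finrank_rootSpace_eq_one α hα) ⟨y, hy⟩
  have : t • x = y := congrArg Subtype.val ht
  exact this ▸ N.smul_mem t hx

/-- `[g_β, g_α]` is nonzero when `α + β` is a weight: from the top of the `β`-chain through `α` one
descends to `g_α`, and raising the resulting vector once does not annihilate it. -/
theorem exists_lie_ne_zero_of_mem_rootSpace {α β : Weight K H L} (hβ : β.IsNonZero)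
    (h : rootSpace H (β + α : H → K) ≠ ⊥) :
    ∃ x ∈ rootSpace H β, ∃ y ∈ rootSpace H α, ⁅x, y⁆ ≠ 0 := by
  have htop : (1 : ℤ) ≤ chainTopCoeff β α := by
    have := (rootSpace_zsmul_add_ne_bot_iff β α hβ 1).mp (by rwa [one_smul])
    exact this.1
  obtain ⟨x, hx, x_ne0⟩ := (chainTop β α).exists_ne_zero
  obtain ⟨h, e, f, isSl2, he, hf⟩ := exists_isSl2Triple_of_weight_isNonZero hβ
  obtain rfl := isSl2.h_eq_coroot hβ he hf
  have prim : isSl2.HasPrimitiveVectorWith x (chainLength β α : K) :=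
    have := lie_mem_genWeightSpace_of_mem_genWeightSpace he hx
    ⟨x_ne0, (chainLength_smul _ _ hx).symm, by rwa [genWeightSpace_add_chainTop _ _ hβ] at this⟩
  obtain ⟨n, hn⟩ : ∃ n : ℕ, chainTopCoeff β α = n + 1 :=
    ⟨chainTopCoeff β α - 1, by omega⟩
  have hlen : n + 1 ≤ chainLength β α := hn ▸ chainTopCoeff_le_chainLength β α
  refine ⟨e, he, (toEnd K L L f ^ (n + 1)) x, ?_, ?_⟩
  · have hmem := toEnd_pow_apply_mem hf hx (n + 1)
    have hw : ((n + 1) • (-β : H → K) + chainTop β α : H → K) = α := by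
      rw [coe_chainTop, hn, smul_neg, natCast_zsmul, neg_add_cancel_left]
    rwa [hw] at hmem
  · rw [prim.lie_e_pow_succ_toEnd_f]
    refine smul_ne_zero (mul_ne_zero (Nat.cast_add_one_ne_zero n) ?_)
      (prim.pow_toEnd_f_ne_zero_of_eq_nat rfl (by omega))
    rw [sub_ne_zero]
    exact_mod_cast (by omega : chainLength β α ≠ n)

variable (H) in
/-- The weights of `H` whose weight space is contained in the subalgebra `p`. If `H ≤ p`, these are
zero and the roots of `p`. -/
def LieSubalgebra.weightsOf (p : LieSubalgebra K L) : Set (Weight K H L) :=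
  {α | (rootSpace H α).toSubmodule ≤ p.toSubmodule}

variable (H) in
/-- The weights of `p` whose negative is not a weight of `p`. If `p` is parabolic, these are the
roots of its nilradical. -/
def LieSubalgebra.unipotentWeightsOf (p : LieSubalgebra K L) : Set (Weight K H L) :=
  {α | α ∈ H.weightsOf p ∧ -α ∉ H.weightsOf p}

variable {p : LieSubalgebra K L}

omit [CharZero K] [IsKilling K L] [IsTriangularizable K H L] in
theorem LieSubalgebra.mem_weightsOf_of_isZero (hHp : H ≤ p) {α : Weight K H L} (hα : α.IsZero) :
    α ∈ H.weightsOf p := by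
  intro x hx
  rw [hα.eq, rootSpace_zero_eq] at hx
  exact hHp hx

theorem LieSubalgebra.add_mem_weightsOf (hHp : H ≤ p) {α β γ : Weight K H L}
    (hα : α ∈ H.weightsOf p) (hβ : β ∈ H.weightsOf p) (hγ : (γ : H → K) = β + α) :
    γ ∈ H.weightsOf p := by
  by_cases hγ0 : γ.IsZero
  · exact mem_weightsOf_of_isZero hHp hγ0
  by_cases hβ0 : β.IsZero
  · have : γ = α := by ext a; rw [hγ, hβ0.eq, zero_add]
    rwa [this]
  obtain ⟨x, hx, y, hy, hxy⟩ := exists_lie_ne_zero_of_mem_rootSpace (α := α) hβ0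
    (by rw [← hγ]; exact γ.genWeightSpace_ne_bot)
  have hmem := lie_mem_genWeightSpace_of_mem_genWeightSpace hx hy
  rw [← hγ] at hmem
  exact Submodule.rootSpace_le_of_mem hγ0 (p.lie_mem (hβ hx) (hα hy)) hmem hxy

theorem LieSubalgebra.add_mem_unipotentWeightsOf (hHp : H ≤ p) {α β γ : Weight K H L}
    (hα : α ∈ H.unipotentWeightsOf p) (hβ : β ∈ H.weightsOf p) (hγ : (γ : H → K) = β + α) :
    γ ∈ H.unipotentWeightsOf p := by
  refine ⟨add_mem_weightsOf hHp hα.1 hβ hγ, fun h => hα.2 ?_⟩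
  exact add_mem_weightsOf hHp h hβ (by rw [Weight.coe_neg, Weight.coe_neg, hγ]; abel)

theorem LieSubalgebra.nsmul_add_mem_unipotentWeightsOf (hHp : H ≤ p) {α β γ : Weight K H L}
    (hα : α ∈ H.unipotentWeightsOf p) (hβ : β ∈ H.weightsOf p) (hβ0 : β.IsNonZero) {n : ℕ}
    (hn : n ≤ chainTopCoeff β α) (hγ : (γ : H → K) = n • (β : H → K) + α) :
    γ ∈ H.unipotentWeightsOf p := by
  induction n generalizing γ with
  | zero =>
    have : γ = α := by ext a; simp [hγ]
    rwa [this]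
  | succ n ih =>
    have hne : rootSpace H ((n : ℤ) • (β : H → K) + α) ≠ ⊥ :=
      (rootSpace_zsmul_add_ne_bot_iff β α hβ0 n).mpr ⟨by omega, by omega⟩
    refine add_mem_unipotentWeightsOf hHp (ih (γ := ⟨_, hne⟩) (by omega) ?_) hβ ?_
    · exact congrArg (· + (α : H → K)) (natCast_zsmul (β : H → K) n)
    · rw [hγ]
      change _ = (β : H → K) + ((n : ℤ) • (β : H → K) + α)
      rw [natCast_zsmul, succ_nsmul]
      abel

/-- Root strings are unbroken, so one passes from `α` to its reflection by adding `β` repeatedly. -/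
theorem LieSubalgebra.reflectRoot_mem_unipotentWeightsOf (hHp : H ≤ p) {α β : Weight K H L}
    (hα : α ∈ H.unipotentWeightsOf p) (hβ : β ∈ H.weightsOf p) (hβ0 : β.IsNonZero) {n : ℤ}
    (hn : α (coroot β) = n) (hn0 : n ≤ 0) : reflectRoot β α ∈ H.unipotentWeightsOf p := by
  have h1 := apply_coroot_eq_cast β α
  rw [hn, Int.cast_inj] at h1
  refine nsmul_add_mem_unipotentWeightsOf hHp hα hβ hβ0 (n := n.natAbs) (by omega) ?_
  change (α : H → K) - α (coroot β) • (β : H → K) = _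
  have h2 : n = -(n.natAbs : ℤ) := by omega
  rw [hn, h2, Int.cast_neg, Int.cast_natCast, neg_smul, Nat.cast_smul_eq_nsmul, sub_neg_eq_add,
    add_comm]
  congr 2
  omega

theorem LieSubalgebra.reflectRoot_mem_unipotentWeightsOf_of_neg_mem (hHp : H ≤ p)
    {α β : Weight K H L} (hα : α ∈ H.unipotentWeightsOf p) (hβ : β ∈ H.weightsOf p)
    (hβ' : -β ∈ H.weightsOf p) (hβ0 : β.IsNonZero) :
    reflectRoot β α ∈ H.unipotentWeightsOf p := by
  have h1 := apply_coroot_eq_cast β α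
  obtain h | h := le_total (chainBotCoeff β α - chainTopCoeff β α : ℤ) 0
  · exact reflectRoot_mem_unipotentWeightsOf hHp hα hβ hβ0 h1 h
  · have h2 : reflectRoot β α = reflectRoot (-β) α := by
      ext a
      simp [reflectRoot]
    rw [h2]
    exact reflectRoot_mem_unipotentWeightsOf hHp hα hβ' hβ0.neg
      (n := -(chainBotCoeff β α - chainTopCoeff β α : ℤ)) (by simp [h1]) (by omega)

theorem coe_reflectionPerm_rootSystem (i k : H.root) :
    ((rootSystem H).reflectionPerm i k : Weight K H L) = reflectRoot i.1 k.1 := by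
  have h := (rootSystem H).root_reflectionPerm i k
  ext a
  have h1 := LinearMap.congr_fun h a
  rw [RootPairing.reflection_apply_root] at h1
  exact h1

/-- The root system of a subalgebra `p ⊇ H` such that for every root `α`, `α` or `-α` is a root of
`p`, is cut out by an integral element of `H`: the sum of the coroots of the nilradical. -/
theorem LieSubalgebra.exists_forall_weight_apply_eq_intCast (hHp : H ≤ p)
    (hp : ∀ α : Weight K H L, α ∈ H.weightsOf p ∨ -α ∈ H.weightsOf p) :
    ∃ Z : H, ∀ α : Weight K H L, ∃ n : ℤ, α Z = n ∧ (α ∈ H.weightsOf p ↔ 0 ≤ n) := by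
  classical
  let P := rootSystem H
  let s : Finset H.root := Finset.univ.filter fun k => k.1 ∈ H.unipotentWeightsOf p
  have hs (k : H.root) : k ∈ s ↔ k.1 ∈ H.unipotentWeightsOf p := by simp [s]
  have hsum (i : H.root) :
      i.1 (∑ k ∈ s, coroot k.1) = ((∑ k ∈ s, P.pairingIn ℤ i k : ℤ) : K) := by
    have : i.1 (∑ k ∈ s, coroot k.1) = ∑ k ∈ s, i.1 (coroot k.1) :=
      map_sum (Weight.toLinear K H L i.1) _ _
    rw [this, Int.cast_sum]
    refine Finset.sum_congr rfl fun k _ => ?_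
    have := P.algebraMap_pairingIn ℤ i k
    rw [rootSystem_pairing_apply] at this
    exact this.symm
  have hpair (i k : H.root) : k.1 (coroot i.1) = (P.pairingIn ℤ k i : K) := by
    have := P.algebraMap_pairingIn ℤ k i
    rw [rootSystem_pairing_apply] at this
    exact this.symm
  have hzero (i : H.root) (h1 : i.1 ∈ H.weightsOf p) (h2 : -i.1 ∈ H.weightsOf p) :
      ∑ k ∈ s, P.pairingIn ℤ i k = 0 := by
    refine P.sum_pairingIn_eq_zero_of_reflectionPerm_mem s i fun k hk => ?_
    rw [hs] at hk ⊢
    rw [coe_reflectionPerm_rootSystem]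
    exact reflectRoot_mem_unipotentWeightsOf_of_neg_mem hHp hk h1 h2
      (LieSubalgebra.isNonZero_coe_root i)
  have hpos (i : H.root) (hi : i.1 ∈ H.unipotentWeightsOf p) :
      0 < ∑ k ∈ s, P.pairingIn ℤ i k := by
    refine P.sum_pairingIn_pos s ((hs i).mpr hi) ?_ fun k hk hlt => ?_
    · rw [hs, coe_reflectionPerm_rootSystem]
      have h1 : reflectRoot i.1 i.1 = -i.1 := by
        ext a
        have h2 : i.1 (coroot i.1) = 2 := root_apply_coroot (LieSubalgebra.isNonZero_coe_root i)
        simp only [reflectRoot, Weight.coe_weight_mk, Weight.coe_neg, h2, Pi.sub_apply,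
          Pi.smul_apply, Pi.neg_apply, smul_eq_mul]
        ring
      rw [h1]
      exact fun h => hi.2 h.1
    · rw [hs] at hk ⊢
      rw [coe_reflectionPerm_rootSystem]
      exact reflectRoot_mem_unipotentWeightsOf hHp hk hi.1 (LieSubalgebra.isNonZero_coe_root i)
        (hpair i k) hlt.le
  refine ⟨∑ k ∈ s, coroot k.1, fun α => ?_⟩
  by_cases hα : α.IsZero
  · exact ⟨0, by simp [hα.eq], by simp [mem_weightsOf_of_isZero hHp hα]⟩
  let i : H.root := ⟨α, by simpa using hα⟩
  refine ⟨_, hsum i, ?_⟩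
  by_cases h1 : α ∈ H.weightsOf p
  · simp only [h1, true_iff]
    by_cases h2 : -α ∈ H.weightsOf p
    · exact (hzero i h1 h2).ge
    · exact (hpos i ⟨h1, h2⟩).le
  · simp only [h1, false_iff, not_le]
    let j : H.root := ⟨-α, by simpa using hα⟩
    have h3 := hpos j ⟨(hp α).resolve_left h1, by simpa [j] using h1⟩
    have h4 : ((∑ k ∈ s, P.pairingIn ℤ j k : ℤ) : K) = -((∑ k ∈ s, P.pairingIn ℤ i k : ℤ) : K) := by
      rw [← hsum, ← hsum]
      simp [i, j]
    have h5 : (∑ k ∈ s, P.pairingIn ℤ j k : ℤ) = -(∑ k ∈ s, P.pairingIn ℤ i k : ℤ) := by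
      exact_mod_cast h4
    omega

end RootSpaces

/-! ### Graded Lie algebras -/

section Graded

open LieAlgebra

section Decomposition

variable {ι K M : Type*} [DecidableEq ι] [Field K] [AddCommGroup M] [Module K M]
  (B : ι → Submodule K M) [DirectSum.Decomposition B]

theorem DirectSum.mem_iSup_iff_forall_decompose_eq_zero (P : ι → Prop) (x : M) :
    x ∈ (⨆ j : ι, ⨆ _ : P j, B j) ↔ ∀ j, ¬ P j → (DirectSum.decompose B x j : M) = 0 := by
  constructor
  · intro hx j hj
    induction hx using Submodule.iSup_induction' with
    | mem i x hx =>
      by_cases hi : P i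
      · rw [iSup_pos hi] at hx
        exact DirectSum.decompose_of_mem_ne B hx (by rintro rfl; exact hj hi)
      · rw [iSup_neg hi, Submodule.mem_bot] at hx
        simp [hx]
    | zero => simp
    | add x y _ _ hx hy => simp [DirectSum.decompose_add, hx, hy]
  · intro h
    classical
    rw [← DirectSum.sum_support_decompose B x]
    refine Submodule.sum_mem _ fun j hj => ?_
    by_cases hP : P j
    · exact Submodule.mem_iSup_of_mem j (Submodule.mem_iSup_of_mem hP (SetLike.coe_mem _))
    · rw [h j hP]
      exact Submodule.zero_mem _

end Decomposition

variable {K L : Type*} [Field K] [LieRing L] [LieAlgebra K L]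

theorem GradedLieAlgebra.lie_mem_iSup_le (B : ℤ → Submodule K L) [GradedLieAlgebra B] {i k : ℤ}
    {x y : L} (hx : x ∈ (⨆ j : ℤ, ⨆ _ : i ≤ j, B j)) (hy : y ∈ (⨆ j : ℤ, ⨆ _ : k ≤ j, B j)) :
    ⁅x, y⁆ ∈ (⨆ j : ℤ, ⨆ _ : i + k ≤ j, B j) := by
  induction hx using Submodule.iSup_induction' with
  | mem a x hx =>
    by_cases ha : i ≤ a
    · rw [iSup_pos ha] at hx
      induction hy using Submodule.iSup_induction' with
      | mem b y hy =>
        by_cases hb : k ≤ b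
        · rw [iSup_pos hb] at hy
          exact Submodule.mem_iSup_of_mem (a + b) (Submodule.mem_iSup_of_mem (add_le_add ha hb)
            (SetLike.GradedBracket.bracket_mem hx hy))
        · rw [iSup_neg hb, Submodule.mem_bot] at hy
          simp [hy]
      | zero => simp
      | add u v _ _ hu hv => rw [lie_add]; exact Submodule.add_mem _ hu hv
    · rw [iSup_neg ha, Submodule.mem_bot] at hx
      simp [hx]
  | zero => simp
  | add u v _ _ hu hv => rw [add_lie]; exact Submodule.add_mem _ hu hv

theorem GradedLieAlgebra.isNilpotent_ad_of_mem_iSup_one_le [FiniteDimensional K L]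
    (B : ℤ → Submodule K L) [GradedLieAlgebra B] {x : L}
    (hx : x ∈ (⨆ j : ℤ, ⨆ _ : 1 ≤ j, B j)) : IsNilpotent (ad K L x) := by
  have hfin : {j | B j ≠ ⊥}.Finite := WellFoundedGT.finite_ne_bot_of_iSupIndep
    (DirectSum.Decomposition.isInternal B).submodule_iSupIndep
  obtain ⟨m, hm⟩ := hfin.bddBelow
  obtain ⟨n, hn⟩ := hfin.bddAbove
  have hpow (k : ℕ) (y : L) : (ad K L x ^ k) y ∈ (⨆ j : ℤ, ⨆ _ : m + k ≤ j, B j) := by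
    induction k with
    | zero =>
      rw [DirectSum.mem_iSup_iff_forall_decompose_eq_zero]
      intro j hj
      have hbot : B j = ⊥ := by
        by_contra h
        exact hj (by simpa using hm h)
      exact (Submodule.mem_bot K).mp (hbot.le (SetLike.coe_mem _))
    | succ k ih =>
      rw [pow_succ', Module.End.mul_apply, ad_apply]
      have := GradedLieAlgebra.lie_mem_iSup_le B hx ih
      rwa [show (1 : ℤ) + (m + k) = m + (k + 1 : ℕ) by push_cast; ring] at this
  refine ⟨(n + 1 - m).toNat, LinearMap.ext fun y => ?_⟩
  have h := hpow (n + 1 - m).toNat y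
  have hle : (⨆ j : ℤ, ⨆ _ : m + ((n + 1 - m).toNat : ℤ) ≤ j, B j) ≤ ⊥ := by
    refine iSup₂_le fun j hj => ?_
    by_contra hne
    have := hn (show B j ≠ ⊥ from fun h => hne h.le)
    omega
  exact (Submodule.mem_bot K).mp (hle h)

/-- The eigenspaces of `ad Z` for integral eigenvalues form a grading once they span. -/
noncomputable abbrev GradedLieAlgebra.ofEigenspaces [CharZero K] (Z : L)
    (hZ : ⨆ j : ℤ, (ad K L Z).eigenspace (j : K) = ⊤) :
    GradedLieAlgebra fun j : ℤ => (ad K L Z).eigenspace (j : K) :=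
  have hint : DirectSum.IsInternal fun j : ℤ => (ad K L Z).eigenspace (j : K) :=
    DirectSum.isInternal_submodule_of_iSupIndep_of_iSup_eq_top
      ((Module.End.eigenspaces_iSupIndep (ad K L Z)).comp Int.cast_injective) hZ
  { hint.chooseDecomposition with
    bracket_mem := by
      intro i j x y hx hy
      rw [Module.End.mem_eigenspace_iff, ad_apply] at hx hy ⊢
      rw [leibniz_lie, hx, hy, smul_lie, lie_smul, ← add_smul, Int.cast_add] }

end Graded

/-! ### Parabolic subalgebras and their Levi factors -/

section Parabolic

open LieAlgebra LieAlgebra.IsKilling LieModule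

variable {K L : Type*} [Field K] [CharZero K] [LieRing L] [LieAlgebra K L] [FiniteDimensional K L]

omit [CharZero K] in
theorem LieIdeal.eq_zero_of_lie_eq_smul_of_isNilpotent {J : LieIdeal K L}
    (hJ : LieRing.IsNilpotent J) {x y : L} (hx : x ∈ J) {t : K} (ht : t ≠ 0)
    (hxy : ⁅x, y⁆ = t • y) : y = 0 := by
  have hy : y ∈ J := by
    have : y = t⁻¹ • ⁅x, y⁆ := by rw [hxy, smul_smul, inv_mul_cancel₀ ht, one_smul]
    rw [this]
    exact J.smul_mem _ (lie_mem_left K L J x y hx)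
  obtain ⟨k, hk⟩ := (LieAlgebra.isNilpotent_iff_forall (R := K)).mp hJ ⟨x, hx⟩
  have hpow (k : ℕ) : (ad K J ⟨x, hx⟩ ^ k) ⟨y, hy⟩ = t ^ k • ⟨y, hy⟩ := by
    induction k with
    | zero => simp
    | succ k ih =>
      rw [pow_succ', Module.End.mul_apply, ih, map_smul, pow_succ, mul_smul]
      congr 1
      exact Subtype.ext hxy
  have h0 := hpow k
  rw [hk, LinearMap.zero_apply, eq_comm, smul_eq_zero] at h0
  exact congrArg Subtype.val (h0.resolve_left (pow_ne_zero k ht))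

variable [IsKilling K L] {H : LieSubalgebra K L} [H.IsCartanSubalgebra] {p : LieSubalgebra K L}

/-- When `α` is not a root of `p`, the root space of `-α` is orthogonal to `p` for the Killing form,
hence orthogonal to the maximal solvable subalgebra `b`, hence contained in `b`. -/
theorem LieSubalgebra.mem_weightsOf_or_neg_mem_weightsOf [IsAlgClosed K] {b : LieSubalgebra K L}
    (hb : Maximal (fun s : LieSubalgebra K L => LieAlgebra.IsSolvable s) b) (hbp : b ≤ p)
    (hHp : H ≤ p) (α : Weight K H L) : α ∈ H.weightsOf p ∨ -α ∈ H.weightsOf p := by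
  by_contra! h
  have hα : α.IsNonZero := fun h0 => h.1 (mem_weightsOf_of_isZero hHp h0)
  refine h.2 fun y hy => hbp (mem_of_maximal_isSolvable_of_killingForm_eq_zero hb fun z hz => ?_)
  have hle : p.toSubmodule ≤ LinearMap.ker (killingForm K L y) := by
    refine Submodule.le_of_forall_mem_rootSpace (H := H) (fun a ha x hx => p.lie_mem (hHp ha) hx) ?_
    intro β x hx hxβ
    rw [LinearMap.mem_ker]
    by_cases hαβ : β = α
    · subst hαβ
      have hx0 : x = 0 := by
        by_contra hx0
        exact h.1 (Submodule.rootSpace_le_of_mem hα hx hxβ hx0)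
      rw [hx0, map_zero]
    · refine killingForm_apply_eq_zero_of_mem_rootSpace_of_add_ne_zero K L H hy hxβ fun h0 => ?_
      refine hαβ (DFunLike.coe_injective ?_)
      rwa [Weight.coe_neg, neg_add_eq_zero, eq_comm] at h0
  exact hle (hbp hz)

variable [IsTriangularizable K H L] {Z : H}

theorem mem_eigenspace_ad_of_mem_rootSpace {α : Weight K H L} {n : ℤ} (hn : α Z = n)
    {x : L} (hx : x ∈ rootSpace H α) : x ∈ (ad K L Z).eigenspace (n : K) := by
  rw [Module.End.mem_eigenspace_iff, ad_apply, ← hn]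
  exact lie_eq_smul_of_mem_rootSpace hx Z

theorem iSup_eigenspace_ad_eq_top (hZ : ∀ α : Weight K H L, ∃ n : ℤ, α Z = n) :
    ⨆ j : ℤ, (ad K L Z).eigenspace (j : K) = ⊤ := by
  rw [eq_top_iff]
  refine Submodule.le_of_forall_mem_rootSpace (H := H) (fun _ _ _ _ => trivial) fun α x _ hx => ?_
  obtain ⟨n, hn⟩ := hZ α
  exact Submodule.mem_iSup_of_mem n (mem_eigenspace_ad_of_mem_rootSpace hn hx)

theorem LieSubalgebra.toSubmodule_eq_iSup_eigenspace_ad (hHp : H ≤ p)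
    (hZ : ∀ α : Weight K H L, ∃ n : ℤ, α Z = n ∧ (α ∈ H.weightsOf p ↔ 0 ≤ n)) :
    p.toSubmodule = ⨆ j : ℤ, ⨆ _ : 0 ≤ j, (ad K L Z).eigenspace (j : K) := by
  refine le_antisymm ?_ (iSup₂_le fun j hj => ?_)
  · refine Submodule.le_of_forall_mem_rootSpace (H := H)
      (fun a ha x hx => p.lie_mem (hHp ha) hx) fun α x hx hxα => ?_
    obtain ⟨n, hn, hW⟩ := hZ α
    by_cases hα : α ∈ H.weightsOf p
    · exact Submodule.mem_iSup_of_mem n (Submodule.mem_iSup_of_mem (hW.mp hα)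
        (mem_eigenspace_ad_of_mem_rootSpace hn hxα))
    · have hx0 : x = 0 := by
        by_contra hx0
        exact hα (Submodule.rootSpace_le_of_mem
          (fun h0 => hα (mem_weightsOf_of_isZero hHp h0)) hx hxα hx0)
      exact hx0 ▸ Submodule.zero_mem _
  · refine Submodule.le_of_forall_mem_rootSpace (H := H) ?_ fun α x hx hxα => ?_
    · intro a ha x hx
      rw [Module.End.mem_eigenspace_iff, ad_apply] at hx ⊢
      have h0 : ⁅(Z : L), a⁆ = 0 := congrArg Subtype.val (trivial_lie_zero H H Z ⟨a, ha⟩)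
      rw [leibniz_lie, h0, zero_lie, zero_add, hx, lie_smul]
    · obtain ⟨n, hn, hW⟩ := hZ α
      by_cases hx0 : x = 0
      · exact hx0 ▸ Submodule.zero_mem _
      have h1 := mem_eigenspace_ad_of_mem_rootSpace hn hxα
      rw [Module.End.mem_eigenspace_iff] at hx h1
      rw [hx] at h1
      have h2 : j = n := by exact_mod_cast smul_left_injective K hx0 h1
      exact hW.mpr (h2 ▸ hj) hxα

/-- The nilradical consists of the positive eigenspaces: these form an ideal of `p`, nilpotent by
Engel's theorem, and an ideal of `p` with a weight vector of degree zero contains an element of `H`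
acting on `p` with a nonzero eigenvalue, so it is not nilpotent. -/
theorem sSup_isNilpotent_map_subtype_eq_iSup_eigenspace_ad (hHp : H ≤ p)
    (hp : ∀ α : Weight K H L, α ∈ H.weightsOf p ∨ -α ∈ H.weightsOf p)
    (hZ : ∀ α : Weight K H L, ∃ n : ℤ, α Z = n ∧ (α ∈ H.weightsOf p ↔ 0 ≤ n)) :
    (sSup {I : LieIdeal K p | LieRing.IsNilpotent I}).toSubmodule.map p.toSubmodule.subtype =
      ⨆ j : ℤ, ⨆ _ : 1 ≤ j, (ad K L Z).eigenspace (j : K) := by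
  let B : ℤ → Submodule K L := fun j => (ad K L Z).eigenspace (j : K)
  let _ : GradedLieAlgebra B := GradedLieAlgebra.ofEigenspaces (Z : L)
    (iSup_eigenspace_ad_eq_top fun α => (hZ α).imp fun _ h => h.1)
  have hpB : p.toSubmodule = ⨆ j : ℤ, ⨆ _ : 0 ≤ j, B j :=
    LieSubalgebra.toSubmodule_eq_iSup_eigenspace_ad hHp hZ
  have hle : (⨆ j : ℤ, ⨆ _ : 1 ≤ j, B j) ≤ p.toSubmodule := by
    rw [hpB]
    exact iSup₂_le fun j hj => le_iSup₂_of_le j (by omega) le_rfl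
  let U : LieIdeal K p :=
    { (⨆ j : ℤ, ⨆ _ : 1 ≤ j, B j).comap p.toSubmodule.subtype with
      lie_mem := by
        intro x y hy
        have hx : (x : L) ∈ ⨆ j : ℤ, ⨆ _ : 0 ≤ j, B j := hpB ▸ x.2
        have := GradedLieAlgebra.lie_mem_iSup_le B hx hy
        rwa [zero_add] at this }
  have hUmem (x : p) : x ∈ U ↔ (x : L) ∈ ⨆ j : ℤ, ⨆ _ : 1 ≤ j, B j := Iff.rfl
  have hUnil : LieRing.IsNilpotent U := by
    rw [LieAlgebra.isNilpotent_iff_forall (R := K)]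
    intro x
    obtain ⟨k, hk⟩ := GradedLieAlgebra.isNilpotent_ad_of_mem_iSup_one_le B ((hUmem _).mp x.2)
    have hcoe (k : ℕ) (y : U) :
        (((ad K U x ^ k) y : p) : L) = (ad K L ((x : p) : L) ^ k) ((y : p) : L) := by
      induction k with
      | zero => simp
      | succ k ih => rw [pow_succ', pow_succ', Module.End.mul_apply, Module.End.mul_apply, ← ih]; rfl
    refine ⟨k, LinearMap.ext fun y => Subtype.ext (Subtype.ext ?_)⟩
    rw [hcoe, hk]
    rfl
  have hJU (J : LieIdeal K p) (hJ : LieRing.IsNilpotent J) : J ≤ U := by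
    have key {x y : L} (hx : x ∈ J.toSubmodule.map p.toSubmodule.subtype) (hy : y ∈ p) {t : K}
        (ht : t ≠ 0) (hxy : ⁅x, y⁆ = t • y) : y = 0 := by
      obtain ⟨x, hx, rfl⟩ := hx
      exact congrArg Subtype.val (LieIdeal.eq_zero_of_lie_eq_smul_of_isNilpotent hJ
        (y := ⟨y, hy⟩) hx ht (Subtype.ext hxy))
    have hNp : J.toSubmodule.map p.toSubmodule.subtype ≤ p.toSubmodule :=
      Submodule.map_subtype_le _ _
    have hNlie {x y : L} (hx : x ∈ J.toSubmodule.map p.toSubmodule.subtype) (hy : y ∈ p) :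
        ⁅y, x⁆ ∈ J.toSubmodule.map p.toSubmodule.subtype := by
      obtain ⟨x, hx, rfl⟩ := hx
      exact ⟨⁅(⟨y, hy⟩ : p), x⁆, J.lie_mem hx, rfl⟩
    have hN : J.toSubmodule.map p.toSubmodule.subtype ≤ ⨆ j : ℤ, ⨆ _ : 1 ≤ j, B j := by
      refine Submodule.le_of_forall_mem_rootSpace (H := H)
        (fun a ha x hx => hNlie hx (hHp ha)) fun α x hx hxα => ?_
      obtain ⟨n, hn, hW⟩ := hZ α
      by_cases hx0 : x = 0
      · exact hx0 ▸ Submodule.zero_mem _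
      by_cases hn1 : 1 ≤ n
      · exact Submodule.mem_iSup_of_mem n (Submodule.mem_iSup_of_mem hn1
          (mem_eigenspace_ad_of_mem_rootSpace hn hxα))
      exfalso
      by_cases hα : α.IsZero
      · -- an element of `H` lying in a nilpotent ideal of `p` is annihilated by every root
        rw [hα.eq, rootSpace_zero_eq] at hxα
        have hxker : (⟨x, hxα⟩ : H) ∈ ⨅ β : Weight K H L, β.ker := by
          rw [Submodule.mem_iInf]
          intro β
          change β ⟨x, hxα⟩ = 0
          by_contra hβ
          obtain h | h := hp β
          · obtain ⟨y, hy, hy0⟩ := β.exists_ne_zero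
            exact hy0 (key hx (h hy) hβ (lie_eq_smul_of_mem_rootSpace hy ⟨x, hxα⟩))
          · obtain ⟨y, hy, hy0⟩ := (-β).exists_ne_zero
            exact hy0 (key hx (h hy) (t := (-β) ⟨x, hxα⟩) (by simpa using hβ)
              (lie_eq_smul_of_mem_rootSpace hy ⟨x, hxα⟩))
        rw [iInf_ker_weight_eq_bot, Submodule.mem_bot] at hxker
        exact hx0 (congrArg Subtype.val hxker)
      · have hαN := Submodule.rootSpace_le_of_mem hα hx hxα hx0
        have h0 : n = 0 := by
          have := hW.mp (hαN.trans hNp)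
          omega
        have hnegW : -α ∈ H.weightsOf p := by
          obtain ⟨n', hn', hW'⟩ := hZ (-α)
          rw [Weight.coe_neg, Pi.neg_apply, hn, h0, Int.cast_zero, neg_zero] at hn'
          have h1 : 0 = n' := by exact_mod_cast hn'
          exact hW'.mpr h1.le
        -- the ideal contains `h = ⁅e, f⁆`, and `⁅h, f⁆ = -2 f` with `f ∈ p`
        obtain ⟨h, e, f, isSl2, he, hf⟩ := exists_isSl2Triple_of_weight_isNonZero hα
        have hf' : f ∈ p := hnegW (by simpa using hf)
        have hh : h ∈ J.toSubmodule.map p.toSubmodule.subtype := by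
          rw [← isSl2.lie_e_f, ← lie_skew]
          exact Submodule.neg_mem _ (hNlie (hαN he) hf')
        refine isSl2.f_ne_zero (key hh hf' (t := -2) (by simp) ?_)
        rw [isSl2.lie_lie_smul_f K, neg_smul]
    exact fun x hx => hN ⟨x, hx, rfl⟩
  have hU : sSup {I : LieIdeal K p | LieRing.IsNilpotent I} = U :=
    le_antisymm (sSup_le hJU) (le_sSup hUnil)
  rw [hU]
  exact (Submodule.map_comap_subtype _ _).trans (inf_eq_right.mpr hle)

theorem LieSubalgebra.toSubmodule_eq_eigenspace_zero_ad {l : LieSubalgebra K L} {N : Submodule K L}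
    (hHl : H ≤ l) (hHp : H ≤ p)
    (hZ : ∀ α : Weight K H L, ∃ n : ℤ, α Z = n ∧ (α ∈ H.weightsOf p ↔ 0 ≤ n))
    (hN : N = ⨆ j : ℤ, ⨆ _ : 1 ≤ j, (ad K L Z).eigenspace (j : K))
    (hdisj : Disjoint l.toSubmodule N) (hsup : l.toSubmodule ⊔ N = p.toSubmodule) :
    l.toSubmodule = (ad K L Z).eigenspace ((0 : ℤ) : K) := by
  let B : ℤ → Submodule K L := fun j => (ad K L Z).eigenspace (j : K)
  let _ : GradedLieAlgebra B := GradedLieAlgebra.ofEigenspaces (Z : L)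
    (iSup_eigenspace_ad_eq_top fun α => (hZ α).imp fun _ h => h.1)
  have hpB : p.toSubmodule = ⨆ j : ℤ, ⨆ _ : 0 ≤ j, B j :=
    LieSubalgebra.toSubmodule_eq_iSup_eigenspace_ad hHp hZ
  have hle : l.toSubmodule ≤ B 0 := by
    refine Submodule.le_of_forall_mem_rootSpace (H := H)
      (fun a ha x hx => l.lie_mem (hHl ha) hx) fun α x hx hxα => ?_
    obtain ⟨n, hn, hW⟩ := hZ α
    have hxn := mem_eigenspace_ad_of_mem_rootSpace hn hxα
    by_cases hx0 : x = 0
    · exact hx0 ▸ Submodule.zero_mem _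
    by_cases hα : α.IsZero
    · rw [hα.eq, Pi.zero_apply, eq_comm, Int.cast_eq_zero] at hn
      rwa [hn] at hxn
    have hxp : x ∈ p.toSubmodule := hsup ▸ Submodule.mem_sup_left hx
    have h0 := hW.mp (Submodule.rootSpace_le_of_mem hα hxp hxα hx0)
    obtain h1 | h1 : n = 0 ∨ 1 ≤ n := by omega
    · rwa [h1] at hxn
    · refine absurd (Submodule.disjoint_def.mp hdisj x hx ?_) hx0
      rw [hN]
      exact Submodule.mem_iSup_of_mem n (Submodule.mem_iSup_of_mem h1 hxn)
  refine le_antisymm hle fun y hy => ?_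
  have hyp : y ∈ l.toSubmodule ⊔ N := by
    rw [hsup, hpB]
    exact Submodule.mem_iSup_of_mem 0 (Submodule.mem_iSup_of_mem le_rfl hy)
  obtain ⟨a, ha, u, hu, rfl⟩ := Submodule.mem_sup.mp hyp
  have hu0 : u ∈ B 0 := by
    have := Submodule.sub_mem _ hy (hle ha)
    rwa [add_sub_cancel_left] at this
  rw [hN] at hu
  have := (DirectSum.mem_iSup_iff_forall_decompose_eq_zero B (fun j => 1 ≤ j) u).mp hu 0 (by simp)
  rw [DirectSum.decompose_of_mem_same B hu0] at this
  rwa [this, add_zero]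

end Parabolic

/-! ### The automorphism of a cyclic grading -/

section Theta

variable {m : ℕ} [NeZero m]

theorem isPrimitiveRoot_cyclicRoot (m : ℕ) [NeZero m] : IsPrimitiveRoot (cyclicRoot m) m :=
  Complex.isPrimitiveRoot_exp m (NeZero.ne m)

theorem sum_cyclicRoot_pow_val_mul_val (i : ZMod m) :
    ∑ k : ZMod m, cyclicRoot m ^ (i.val * k.val) = if i = 0 then (m : ℂ) else 0 := by
  have hω := isPrimitiveRoot_cyclicRoot m
  split_ifs with hi
  · simp [hi, ZMod.card]
  · have hsum : ∑ k : ZMod m, (cyclicRoot m ^ i.val) ^ k.val =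
        ∑ k ∈ Finset.range m, (cyclicRoot m ^ i.val) ^ k := by
      cases m with
      | zero => exact absurd rfl (NeZero.ne 0)
      | succ n => exact Fin.sum_univ_eq_sum_range (fun k => (cyclicRoot (n + 1) ^ i.val) ^ k) (n + 1)
    simp only [pow_mul]
    rw [hsum]
    have h1 := mul_geom_sum (cyclicRoot m ^ i.val) m
    rw [← pow_mul, mul_comm i.val, pow_mul, hω.pow_eq_one, one_pow, sub_self] at h1
    refine (mul_eq_zero.mp h1).resolve_left (sub_ne_zero.mpr ?_)
    exact hω.pow_ne_one_of_pos_of_lt (by simpa using hi) (ZMod.val_lt i)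

variable {g : Type*} [LieRing g] [LieAlgebra ℂ g] (A : ZMod m → Submodule ℂ g) [GradedLieAlgebra A]

theorem theta_pow_apply_of_mem {i : ZMod m} {x : g} (hx : x ∈ A i) (k : ℕ) :
    (theta A ^ k) x = cyclicRoot m ^ (i.val * k) • x := by
  induction k with
  | zero => simp
  | succ k ih =>
    rw [pow_succ', Module.End.mul_apply, ih, map_smul, theta_apply_of_mem A hx, smul_smul,
      mul_add_one, pow_add]

theorem theta_lie (x y : g) : theta A ⁅x, y⁆ = ⁅theta A x, theta A y⁆ := by
  induction x using DirectSum.Decomposition.inductionOn A with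
  | zero => simp
  | add u v hu hv => simp [hu, hv]
  | homogeneous x =>
    rename_i i
    induction y using DirectSum.Decomposition.inductionOn A with
    | zero => simp
    | add u v hu hv => simp [hu, hv]
    | homogeneous y =>
      rename_i j
      rw [theta_apply_of_mem A x.2, theta_apply_of_mem A y.2,
        theta_apply_of_mem A (SetLike.GradedBracket.bracket_mem x.2 y.2), smul_lie, lie_smul,
        smul_smul, ← pow_add, ZMod.val_add,
        ← pow_eq_pow_mod _ (isPrimitiveRoot_cyclicRoot m).pow_eq_one]

theorem theta_pow_lie (k : ℕ) (x y : g) :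
    (theta A ^ k) ⁅x, y⁆ = ⁅(theta A ^ k) x, (theta A ^ k) y⁆ := by
  induction k with
  | zero => simp
  | succ k ih => simp only [pow_succ', Module.End.mul_apply, ih, theta_lie]

theorem theta_pow_eq_one : theta A ^ m = 1 := by
  ext x
  induction x using DirectSum.Decomposition.inductionOn A with
  | zero => simp
  | add u v hu hv => rw [map_add, hu, hv, map_add]
  | homogeneous x =>
    rw [theta_pow_apply_of_mem A x.2, mul_comm, pow_mul,
      (isPrimitiveRoot_cyclicRoot m).pow_eq_one, one_pow, one_smul, Module.End.one_apply]

theorem sum_theta_pow_apply (x : g) :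
    ∑ k : ZMod m, (theta A ^ k.val) x = (m : ℂ) • gradedProj A 0 x := by
  induction x using DirectSum.Decomposition.inductionOn A with
  | zero => simp
  | add u v hu hv => simp only [map_add, Finset.sum_add_distrib, hu, hv, smul_add]
  | homogeneous x =>
    rename_i i
    have hproj : gradedProj A 0 (x : g) = (DirectSum.decompose A (x : g) 0 : g) := rfl
    simp only [theta_pow_apply_of_mem A x.2]
    rw [← Finset.sum_smul, sum_cyclicRoot_pow_val_mul_val, hproj]
    split_ifs with hi
    · subst hi
      rw [DirectSum.decompose_of_mem_same A x.2]
    · rw [DirectSum.decompose_of_mem_ne A x.2 hi, zero_smul, smul_zero]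

theorem theta_pow_sub_theta_pow (k : ZMod m) (x : g) :
    (theta A ^ (m - k.val)) ((theta A ^ k.val) x) = x := by
  rw [← Module.End.mul_apply, ← pow_add, Nat.sub_add_cancel (ZMod.val_lt k).le, theta_pow_eq_one,
    Module.End.one_apply]

theorem theta_pow_injective (k : ℕ) : Function.Injective (theta A ^ k) := by
  have hunit : IsUnit (theta A ^ k) :=
    (IsUnit.of_pow_eq_one (theta_pow_eq_one A) (NeZero.ne m)).pow k
  exact ((Module.End.isUnit_iff _).mp hunit).injective

end Theta

/-! ### Grading elements -/

section GradingElement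

open LieAlgebra

variable {g : Type*} [LieRing g] [LieAlgebra ℂ g] (B : ℤ → Submodule ℂ g) [GradedLieAlgebra B]

/-- Derivations of a semisimple Lie algebra are inner, and its center is trivial. -/
theorem existsUnique_isGradingElement [FiniteDimensional ℂ g] [IsKilling ℂ g] :
    ∃! Z : g, IsGradingElement B Z := by
  obtain ⟨Z, hZ⟩ := LieDerivation.IsKilling.exists_eq_ad (R := ℂ) (L := g)
    (LieDerivation.ofGrading B (Int.castAddHom ℂ))
  refine ⟨Z, fun j x hx => ?_, fun Z' hZ' => ?_⟩
  · have h1 := LieDerivation.congr_fun hZ x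
    rw [LieDerivation.ofGrading_apply_apply B _ hx, LieDerivation.ad_apply_apply] at h1
    exact h1
  · have hcen : Z' - Z ∈ LieAlgebra.center ℂ g := by
      rw [LieModule.mem_maxTrivSubmodule]
      intro x
      induction x using DirectSum.Decomposition.inductionOn B with
      | zero => simp
      | add u v hu hv => rw [add_lie, hu, hv, add_zero]
      | homogeneous x =>
        have h1 := LieDerivation.congr_fun hZ x
        rw [LieDerivation.ofGrading_apply_apply B _ x.2, LieDerivation.ad_apply_apply] at h1
        rw [← lie_skew, sub_lie, hZ' _ _ x.2, h1]
        simp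
    rw [LieAlgebra.center_eq_bot, LieSubmodule.mem_bot, sub_eq_zero] at hcen
    exact hcen

variable {B}

theorem IsGradingElement.decompose_lie {Z : g} (hZ : IsGradingElement B Z) (y : g) (j : ℤ) :
    (DirectSum.decompose B ⁅Z, y⁆ j : g) = (j : ℂ) • (DirectSum.decompose B y j : g) := by
  induction y using DirectSum.Decomposition.inductionOn B with
  | zero => simp
  | add u v hu hv => simp only [lie_add, DirectSum.decompose_add, DirectSum.add_apply,
      Submodule.coe_add, hu, hv, smul_add]
  | homogeneous y =>
    rename_i i
    rw [hZ i y y.2]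
    by_cases hij : i = j
    · subst hij
      rw [DirectSum.decompose_of_mem_same B (Submodule.smul_mem _ _ y.2),
        DirectSum.decompose_of_mem_same B y.2]
    · rw [DirectSum.decompose_of_mem_ne B (Submodule.smul_mem _ _ y.2) hij,
        DirectSum.decompose_of_mem_ne B y.2 hij, smul_zero]

theorem IsGradingElement.exists_eq_intCast_of_lie_eq_smul {Z : g} (hZ : IsGradingElement B Z)
    {y : g} (hy : y ≠ 0) {t : ℂ} (hyt : ⁅Z, y⁆ = t • y) :
    ∃ j : ℤ, t = j ∧ (DirectSum.decompose B y j : g) ≠ 0 := by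
  have hex : ∃ j : ℤ, (DirectSum.decompose B y j : g) ≠ 0 := by
    by_contra! h
    refine hy ((DirectSum.decompose B).injective (DFinsupp.ext fun j => Subtype.ext ?_))
    rw [h j, DirectSum.decompose_zero]
    rfl
  obtain ⟨j, hj⟩ := hex
  refine ⟨j, ?_, hj⟩
  have h1 := hZ.decompose_lie y j
  rw [hyt, DirectSum.decompose_smul, DirectSum.smul_apply, Submodule.coe_smul] at h1
  exact smul_left_injective ℂ hj h1

end GradingElement

section Modes

open LieAlgebra LieModule

variable {m : ℕ} [NeZero m] {g : Type*} [LieRing g] [LieAlgebra ℂ g] [FiniteDimensional ℂ g]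
  [IsKilling ℂ g] (A : ZMod m → Submodule ℂ g) [GradedLieAlgebra A]
  {h : LieSubalgebra ℂ g} [h.IsCartanSubalgebra] (hh : IsHomogeneousSubalgebra A h)

omit [IsKilling ℂ g] in
theorem mul_mode_zero_eq_sum_thetaValue (α : Weight ℂ h g) (Z : h) :
    (m : ℂ) * mode A hh α Z 0 = ∑ k : ZMod m, thetaValue A hh α Z k := by
  have h1 : ∑ k : ZMod m, (⟨(theta A ^ k.val) Z, theta_pow_mem A hh Z.2 k.val⟩ : h) =
      (m : ℂ) • ⟨gradedProj A 0 Z, hh 0 Z Z.2⟩ := by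
    refine Subtype.ext ?_
    rw [AddSubmonoidClass.coe_finsetSum]
    exact sum_theta_pow_apply A (Z : g)
  have h2 := congrArg (Weight.toLinear ℂ h g α) h1
  rw [map_sum, map_smul, smul_eq_mul] at h2
  exact h2.symm

/-- `θ ^ k Z` acts on the root vector `x` as `Z` acts on `θ ^ (-k) x`. -/
theorem lie_theta_pow_sub_eq_thetaValue_smul (α : Weight ℂ h g) (Z : h) (k : ZMod m) {x : g}
    (hx : x ∈ rootSpace h α) :
    ⁅(Z : g), (theta A ^ (m - k.val)) x⁆ = thetaValue A hh α Z k • (theta A ^ (m - k.val)) x := by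
  have h1 : ⁅(theta A ^ k.val) (Z : g), x⁆ = thetaValue A hh α Z k • x :=
    IsKilling.lie_eq_smul_of_mem_rootSpace hx ⟨_, theta_pow_mem A hh Z.2 k.val⟩
  have h2 := congrArg (theta A ^ (m - k.val)) h1
  rwa [theta_pow_lie, theta_pow_sub_theta_pow, map_smul] at h2

end Modes

/-! ### The grading defined by a parabolic subalgebra -/

section Main

open LieAlgebra LieModule

variable {g : Type*} [LieRing g] [LieAlgebra ℂ g] [FiniteDimensional ℂ g] [IsKilling ℂ g]
  {h : LieSubalgebra ℂ g} [h.IsCartanSubalgebra] {p l : LieSubalgebra ℂ g}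

theorem exists_grading_of_isParabolicSubalgebra (hhl : h ≤ l) (hp : IsParabolicSubalgebra p)
    (hl : IsLeviFactor p l) :
    ∃ (B : ℤ → Submodule ℂ g) (_ : GradedLieAlgebra B), GradingDefines B p l := by
  obtain ⟨b, hb, hbp⟩ := hp
  have hlp : l ≤ p := fun x hx => hl.2.le (Submodule.mem_sup_left hx)
  have hhp : h ≤ p := hhl.trans hlp
  have hpar (α : Weight ℂ h g) := LieSubalgebra.mem_weightsOf_or_neg_mem_weightsOf hb hbp hhp α
  obtain ⟨Z, hZ⟩ := LieSubalgebra.exists_forall_weight_apply_eq_intCast hhp hpar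
  exact ⟨_, GradedLieAlgebra.ofEigenspaces (Z : g)
      (iSup_eigenspace_ad_eq_top fun α => (hZ α).imp fun _ h => h.1),
    LieSubalgebra.toSubmodule_eq_iSup_eigenspace_ad hhp hZ,
    LieSubalgebra.toSubmodule_eq_eigenspace_zero_ad hhl hhp hZ
      (sSup_isNilpotent_map_subtype_eq_iSup_eigenspace_ad hhp hpar hZ) hl.1 hl.2⟩

omit [FiniteDimensional ℂ g] [IsKilling ℂ g] in
theorem IsGradingElement.mem_of_gradingDefines {B : ℤ → Submodule ℂ g}
    (hB : GradingDefines B p l) {Z : g} (hZ : IsGradingElement B Z) (hhl : h ≤ l) : Z ∈ h := by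
  rw [← LieSubalgebra.IsCartanSubalgebra.self_normalizing (H := h), LieSubalgebra.mem_normalizer_iff]
  intro x hx
  have h0 : ⁅Z, x⁆ = 0 := by
    rw [hZ 0 x (hB.2.le (hhl hx)), Int.cast_zero, zero_smul]
  rw [h0]
  exact h.zero_mem

variable {m : ℕ} [NeZero m] (A : ZMod m → Submodule ℂ g) [GradedLieAlgebra A]

/-- If `p` is `θ`-stable and `α` is a root of `p`, the numbers `α (θ ^ k Z)` are eigenvalues of `Z`
on `p`, hence non-negative; if their sum, a multiple of `α (Z_0)`, vanishes, so does `α (Z)`. -/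
theorem apply_eq_zero_of_isThetaStable (hh : IsHomogeneousSubalgebra A h)
    (h0 : h.toSubmodule ⊓ A 0 = ⊥) (hθ : IsThetaStable A p) {B : ℤ → Submodule ℂ g}
    [GradedLieAlgebra B] (hB : GradingDefines B p l) {Z : h} (hZ : IsGradingElement B (Z : g))
    {α : Weight ℂ h g} (hα : α ∈ h.weightsOf p) : α Z = 0 := by
  obtain ⟨x, hx, hx0⟩ := α.exists_ne_zero
  have hnn (k : ZMod m) : ∃ n : ℕ, thetaValue A hh α Z k = n := by
    have hy0 : (theta A ^ (m - k.val)) x ≠ 0 :=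
      fun h => hx0 (theta_pow_injective A _ (h.trans (map_zero _).symm))
    have hyp (k : ℕ) : (theta A ^ k) x ∈ p := by
      induction k with
      | zero => exact hα hx
      | succ k ih => rw [pow_succ', Module.End.mul_apply]; exact hθ _ ih
    obtain ⟨j, hj, hj0⟩ := hZ.exists_eq_intCast_of_lie_eq_smul hy0
      (lie_theta_pow_sub_eq_thetaValue_smul A hh α Z k hx)
    have hj1 : 0 ≤ j := by
      by_contra hlt
      exact hj0 ((DirectSum.mem_iSup_iff_forall_decompose_eq_zero B (fun j => 0 ≤ j) _).mp
        (hB.1.le (hyp _)) j hlt)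
    lift j to ℕ using hj1
    exact ⟨j, by simpa using hj⟩
  choose n hn using hnn
  have hZ0 : gradedProj A 0 (Z : g) = 0 := by
    have hmem : gradedProj A 0 (Z : g) ∈ h.toSubmodule ⊓ A 0 :=
      ⟨hh 0 Z Z.2, SetLike.coe_mem (DirectSum.decompose A (Z : g) 0)⟩
    rwa [h0, Submodule.mem_bot] at hmem
  have hmode : mode A hh α Z 0 = 0 := by
    have h1 : (⟨gradedProj A 0 (Z : g), hh 0 Z Z.2⟩ : h) = 0 := Subtype.ext hZ0
    rw [mode, h1]
    exact map_zero (Weight.toLinear ℂ h g α)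
  have hsum := mul_mode_zero_eq_sum_thetaValue A hh α Z
  simp only [hn] at hsum
  rw [hmode, mul_zero, ← Nat.cast_sum, eq_comm, Nat.cast_eq_zero, Finset.sum_eq_zero_iff] at hsum
  have h1 : thetaValue A hh α Z 0 = 0 := by
    rw [hn, hsum 0 (Finset.mem_univ _), Nat.cast_zero]
  have h2 : (⟨(theta A ^ (0 : ZMod m).val) Z, theta_pow_mem A hh Z.2 _⟩ : h) = Z :=
    Subtype.ext (by simp)
  rwa [thetaValue, h2] at h1

end Main

theorem mainTheorem9 {m : ℕ} [NeZero m] {g : Type*} [LieRing g] [LieAlgebra ℂ g]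
    [FiniteDimensional ℂ g] [LieAlgebra.IsSemisimple ℂ g]
    (A : ZMod m → Submodule ℂ g) [GradedLieAlgebra A]
    (c : Submodule ℂ g) (hc : IsCartanSubspace A c)
    (h : LieSubalgebra ℂ g) [h.IsCartanSubalgebra] (hh : IsAdapted A c h)
    (p l : LieSubalgebra ℂ g) (hp : IsParabolicSubalgebra p) (hl : IsLeviFactor p l)
    (hlA : IsHomogeneousSubalgebra A l) (hcl : lieCentralizer c ≤ l) :
    (∃ (B : ℤ → Submodule ℂ g) (_ : GradedLieAlgebra B), GradingDefines B p l) ∧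
    (∀ (B : ℤ → Submodule ℂ g) [GradedLieAlgebra B], GradingDefines B p l →
      (∃! Z : g, IsGradingElement B Z) ∧
      ∀ Z : g, IsGradingElement B Z → ∃ hZ : Z ∈ h,
        ∀ α : LieModule.Weight ℂ h g, α.IsNonZero →
          (∀ k : ZMod m, ∃ n : ℤ, thetaValue A hh.homogeneous α ⟨Z, hZ⟩ k = n) ∧
          (m : ℂ) * mode A hh.homogeneous α ⟨Z, hZ⟩ 0 =
            ∑ k : ZMod m, thetaValue A hh.homogeneous α ⟨Z, hZ⟩ k ∧
          ∃ n : ℤ, mode A hh.homogeneous α ⟨Z, hZ⟩ 0 = (1 / m : ℂ) * n) ∧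
    (h.toSubmodule ⊓ A 0 = ⊥ → p ≠ ⊤ → ¬ IsThetaStable A p) := by
  -- `h` is abelian and contains `c`, so it centralizes `c`
  have hhl : h ≤ l := by
    refine le_trans ?_ hcl
    intro x hx y hy
    have hyh : y ∈ h := (hh.degree_one.ge hy).1
    exact congrArg Subtype.val (trivial_lie_zero h h ⟨x, hx⟩ ⟨y, hyh⟩)
  have hgrad := exists_grading_of_isParabolicSubalgebra hhl hp hl
  refine ⟨hgrad, ?_, ?_⟩
  · intro B _ hB
    refine ⟨existsUnique_isGradingElement B, fun Z hZ => ?_⟩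
    have hZh : Z ∈ h := hZ.mem_of_gradingDefines hB hhl
    refine ⟨hZh, fun α _ => ?_⟩
    have hint (k : ZMod m) : ∃ n : ℤ, thetaValue A hh.homogeneous α ⟨Z, hZh⟩ k = n := by
      obtain ⟨x, hx, hx0⟩ := α.exists_ne_zero
      obtain ⟨j, hj, -⟩ := hZ.exists_eq_intCast_of_lie_eq_smul
        (fun h => hx0 (theta_pow_injective A _ (h.trans (map_zero _).symm)))
        (lie_theta_pow_sub_eq_thetaValue_smul A hh.homogeneous α ⟨Z, hZh⟩ k hx)
      exact ⟨j, hj⟩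
    have hsum := mul_mode_zero_eq_sum_thetaValue A hh.homogeneous α ⟨Z, hZh⟩
    refine ⟨hint, hsum, ?_⟩
    choose n hn using hint
    refine ⟨∑ k, n k, ?_⟩
    have hm : (m : ℂ) ≠ 0 := Nat.cast_ne_zero.mpr (NeZero.ne m)
    simp only [hn] at hsum
    rw [Int.cast_sum, ← hsum]
    field_simp
  · intro h0 hpt hθ
    obtain ⟨B, _, hB⟩ := hgrad
    obtain ⟨Z, hZ, -⟩ := existsUnique_isGradingElement B
    have hZh : Z ∈ h := hZ.mem_of_gradingDefines hB hhl
    obtain ⟨b, hb, hbp⟩ := hp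
    have hhp : h ≤ p := fun x hx => hl.2.le (Submodule.mem_sup_left (hhl hx))
    have hW (α : LieModule.Weight ℂ h g) : α ∈ h.weightsOf p := by
      obtain hα | hα := LieSubalgebra.mem_weightsOf_or_neg_mem_weightsOf hb hbp hhp α
      · exact hα
      -- `α` vanishes on `Z` together with `-α`, so its root space has degree zero and lies in `p`
      have h1 := apply_eq_zero_of_isThetaStable A hh.homogeneous h0 hθ hB (Z := ⟨Z, hZh⟩) hZ hα
      rw [LieModule.Weight.coe_neg, Pi.neg_apply, neg_eq_zero] at h1
      intro x hx
      have hlie : ⁅Z, x⁆ = (0 : ℂ) • x :=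
        h1 ▸ LieAlgebra.IsKilling.lie_eq_smul_of_mem_rootSpace hx ⟨Z, hZh⟩
      refine hB.1.ge ((DirectSum.mem_iSup_iff_forall_decompose_eq_zero B (fun j => 0 ≤ j) x).mpr
        fun j hj => ?_)
      have h2 := hZ.decompose_lie x j
      rw [hlie, zero_smul, DirectSum.decompose_zero, DirectSum.zero_apply, Submodule.coe_zero,
        eq_comm, smul_eq_zero, Int.cast_eq_zero] at h2
      exact h2.resolve_left (by omega)
    refine hpt (top_le_iff.mp ?_)
    exact Submodule.le_of_forall_mem_rootSpace (H := h) (N := ⊤) (M := p.toSubmodule)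
      (fun _ _ _ _ => trivial) fun α x _ hx => hW α hx
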